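/- Let $G$ be a group. The weight $w(G)$ is the minimal number of elements whose normal closure is $G$, and a normally generating $n$-vector of $G$ is an element $(g_1,\dots,g_n)\in G^n$ whose components have normal closure $G$. An elementary AC-transformation of $G^n$ replaces, for some $i$, the component $g_i$ by $g_jg_i$ for some $j\neq i$, or by $g_i^{-1}$, or by $g^{-1}g_ig$ for some $g\in G$, and leaves the other components unchanged. Two normally generating $n$-vectors are AC-equivalent if one is carried to the other by a composition of finitely many elementary AC-transformations. Let $W(G)$ be the intersection of all maximal normal subgroups of $G$ (that is, of the maximal elements among the proper normal subgroups), with $W(G)=G$ if there are none. Let $\mathcal{W}$ be the class of groups $G$ such that $G/W(G)$ is finite, or abelian, or isomorphic to a direct product $S_1\times\cdots\times S_k$ of finitely many non-abelian simple groups. Let $G$ be a finitely generated group in $\mathcal{W}$. Then for every $n>w(G)$, any two normally generating $n$-vectors of $G$ are AC-equivalent. -/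

import Mathlib

namespace AndrewsCurtis

universe u

/-- The components of the `n`-vector `v` normally generate `G`. -/
def NormallyGenerates {G : Type u} [Group G] {n : ℕ} (v : Fin n → G) : Prop :=
  Subgroup.normalClosure (Set.range v) = ⊤

/-- The weight of `G`: the minimal number of elements which normally generate `G`
(the value is `⊤` if no finite set does). -/
noncomputable def weight (G : Type u) [Group G] : ℕ∞ :=
  ⨅ (s : Set G) (_ : Subgroup.normalClosure s = ⊤), s.encard

/-- `ElementaryAC v w`: an elementary Andrews-Curtis transformation turns `v` into `w`. The
constructors `mul` and `inv` are the elementary Nielsen transformations. -/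
inductive ElementaryAC {G : Type u} [Group G] {n : ℕ} : (Fin n → G) → (Fin n → G) → Prop
  | mul (v : Fin n → G) (i j : Fin n) (hij : j ≠ i) :
      ElementaryAC v (Function.update v i (v j * v i))
  | inv (v : Fin n → G) (i : Fin n) :
      ElementaryAC v (Function.update v i (v i)⁻¹)
  | conj (v : Fin n → G) (i : Fin n) (g : G) :
      ElementaryAC v (Function.update v i (g⁻¹ * v i * g))

/-- Two vectors are AC-equivalent if a finite (possibly empty) composition of elementary
AC-transformations turns the first into the second. -/
def ACEquivalent {G : Type u} [Group G] {n : ℕ} (v w : Fin n → G) : Prop :=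
  Relation.ReflTransGen ElementaryAC v w

/-- A maximal normal subgroup: a maximal element among the proper normal subgroups (it need not be
maximal among all proper subgroups). -/
def IsMaximalNormal {G : Type u} [Group G] (M : Subgroup G) : Prop :=
  Maximal (fun N : Subgroup G => N.Normal ∧ N ≠ ⊤) M

/-- The `N`-Frattini subgroup `W(G)`: the intersection of all maximal normal subgroups, which is
`G` itself if there are none. -/
def nFrattini (G : Type u) [Group G] : Subgroup G :=
  sInf {M : Subgroup G | IsMaximalNormal M}

instance nFrattini_normal (G : Type u) [Group G] : (nFrattini G).Normal := by
  refine ⟨fun x hx g => ?_⟩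
  simp only [nFrattini, Subgroup.mem_sInf] at hx ⊢
  intro M hM
  have hN : M.Normal := (show IsMaximalNormal M from hM).1.1
  exact hN.conj_mem x (hx M hM) g

/-- `H` is isomorphic to a direct product of finitely many non-abelian simple groups. -/
def IsFiniteProductOfNonabelianSimple (H : Type u) [Group H] : Prop :=
  ∃ (k : ℕ) (S : Fin k → Type u) (_ : ∀ i, Group (S i)),
    (∀ i, IsSimpleGroup (S i) ∧ ¬ ∀ a b : S i, a * b = b * a) ∧ Nonempty (H ≃* ∀ i, S i)

/-- The class `𝒲` of groups. -/
def InClassW (G : Type u) [Group G] : Prop :=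
  Finite (G ⧸ nFrattini G) ∨
  (∀ a b : G ⧸ nFrattini G, a * b = b * a) ∨
  IsFiniteProductOfNonabelianSimple (G ⧸ nFrattini G)

/-- The weak form of the generalized Andrews-Curtis conjecture: for every `n > w(G)`, any two
normally generating `n`-vectors of `G` are AC-equivalent. -/
def SatisfiesWeakGAC (G : Type u) [Group G] : Prop :=
  ∀ n : ℕ, weight G < n → ∀ v w : Fin n → G,
    NormallyGenerates v → NormallyGenerates w → ACEquivalent v w

end AndrewsCurtis

/-! A component may be multiplied by any element of the normal closure of the others
(`acEquivalent_update_of_mem`), so a redundant component can be changed at will. For n ≥ 2 fix a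
normally generating vector u with n - 1 components; it suffices to bring every v to (1, u).

Work in H = G/W(G). In all three cases [H,H] meets the intersection of finitely many maximal normal
subgroups with non-abelian quotient trivially (`HasSemisimpleCommutator`). These subgroups behave
like prime ideals, so one component can be moved off all of them, and its normal closure then
contains [H,H]. This absorbs all discrepancies in [H,H] and reduces the problem to the
abelianization of H. There a cyclic quotient of the same exponent splits off one component, and
induction applies to its kernel (`acEquivalent_of_commGroup`).

Back in G, v has become (g, x) with x ≡ u modulo W(G). Since G is finitely generated, W(G) is
irrelevant to normal generation: every mixture of x and u normally generates G. Hence g is a spare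
slot through which each x_j is exchanged for u_j (`acEquivalent_cons_of_eq`). -/

namespace AndrewsCurtis

universe u

/-! ### Calculus of AC-moves, their images and lifts -/

section Moves

variable {G : Type*} [Group G] {n : ℕ}

theorem ElementaryAC.equiv {v w : Fin n → G} (h : ElementaryAC v w) : ACEquivalent v w :=
  Relation.ReflTransGen.single h

theorem ACEquivalent.trans {v w x : Fin n → G} (h : ACEquivalent v w) (h' : ACEquivalent w x) :
    ACEquivalent v x :=
  Relation.ReflTransGen.trans h h'

theorem ACEquivalent.refl (v : Fin n → G) : ACEquivalent v v := Relation.ReflTransGen.refl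

theorem acEquivalent_update_inv (v : Fin n → G) (i : Fin n) (x : G) :
    ACEquivalent (Function.update v i x) (Function.update v i x⁻¹) := by
  simpa using (ElementaryAC.inv (Function.update v i x) i).equiv

theorem acEquivalent_update_conj (v : Fin n → G) (i : Fin n) (x g : G) :
    ACEquivalent (Function.update v i x) (Function.update v i (g⁻¹ * x * g)) := by
  simpa using (ElementaryAC.conj (Function.update v i x) i g).equiv

theorem acEquivalent_update_mul (v : Fin n → G) {i j : Fin n} (hij : j ≠ i) (x : G) :
    ACEquivalent (Function.update v i x) (Function.update v i (v j * x)) := by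
  simpa [hij] using (ElementaryAC.mul (Function.update v i x) i j hij).equiv

theorem acEquivalent_update_inv_mul (v : Fin n → G) {i j : Fin n} (hij : j ≠ i) (x : G) :
    ACEquivalent (Function.update v i x) (Function.update v i ((v j)⁻¹ * x)) := by
  have h1 := acEquivalent_update_inv (Function.update v i x) j (v j)
  have h2 := acEquivalent_update_mul (Function.update v j (v j)⁻¹) hij x
  have h3 := acEquivalent_update_inv (Function.update v i ((v j)⁻¹ * x)) j (v j)⁻¹
  rw [Function.update_comm hij.symm, Function.update_comm hij.symm,
    Function.update_eq_self] at h1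
  rw [Function.update_self] at h2
  rw [Function.update_comm hij.symm, Function.update_comm hij.symm, inv_inv,
    Function.update_eq_self] at h3
  exact (h1.trans h2).trans h3

theorem ElementaryAC.reverse {v w : Fin n → G} (h : ElementaryAC v w) : ACEquivalent w v := by
  cases h with
  | mul i j hij => simpa using acEquivalent_update_inv_mul v hij (v j * v i)
  | inv i => simpa using acEquivalent_update_inv v i (v i)⁻¹
  | conj i g => simpa [mul_assoc] using acEquivalent_update_conj v i (g⁻¹ * v i * g) g⁻¹

theorem ACEquivalent.symm {v w : Fin n → G} (h : ACEquivalent v w) : ACEquivalent w v := by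
  induction h with
  | refl => exact .refl _
  | tail _ h ih => exact h.reverse.trans ih

/-- The normal closure of the components of `v` other than the `i`-th. -/
def othersClosure (v : Fin n → G) (i : Fin n) : Subgroup G :=
  Subgroup.normalClosure (v '' {i}ᶜ)

instance (v : Fin n → G) (i : Fin n) : (othersClosure v i).Normal :=
  Subgroup.normalClosure_normal

theorem mem_othersClosure (v : Fin n → G) {i j : Fin n} (h : j ≠ i) : v j ∈ othersClosure v i :=
  Subgroup.subset_normalClosure ⟨j, h, rfl⟩

theorem normalClosure_singleton_le_othersClosure (v : Fin n → G) {i j : Fin n} (h : j ≠ i) :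
    Subgroup.normalClosure {v j} ≤ othersClosure v i :=
  Subgroup.normalClosure_le_normal (by simpa using mem_othersClosure v h)

/-- To multiply by a conjugate of `v j`, conjugate `x`, multiply by `v j`, conjugate back. -/
theorem acEquivalent_update_of_mem (v : Fin n → G) (i : Fin n) {k : G}
    (hk : k ∈ othersClosure v i) (x : G) :
    ACEquivalent (Function.update v i x) (Function.update v i (k * x)) := by
  unfold othersClosure Subgroup.normalClosure at hk
  induction hk using Subgroup.closure_induction generalizing x with
  | mem k hk =>
    obtain ⟨_, ⟨j, hj, rfl⟩, hc⟩ := Group.mem_conjugatesOfSet_iff.1 hk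
    obtain ⟨g, rfl⟩ := isConj_iff.1 hc
    have h1 := acEquivalent_update_conj v i x g
    have h2 := acEquivalent_update_mul v hj (g⁻¹ * x * g)
    have h3 := acEquivalent_update_conj v i (v j * (g⁻¹ * x * g)) g⁻¹
    have := (h1.trans h2).trans h3
    convert this using 2
    group
  | one => simpa using .refl _
  | mul a b _ _ ha hb =>
    rw [mul_assoc]
    exact (hb x).trans (ha _)
  | inv a _ ha => simpa using (ha (a⁻¹ * x)).symm

theorem acEquivalent_update (v : Fin n → G) (i : Fin n) {h : G}
    (hh : h * (v i)⁻¹ ∈ othersClosure v i) : ACEquivalent v (Function.update v i h) := by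
  simpa using acEquivalent_update_of_mem v i hh (v i)

/-- Components of `v` other than the `i`-th may be changed modulo the normal closure
of the `i`-th. -/
theorem acEquivalent_of_normalClosure {v w : Fin n → G} (i : Fin n) (hi : v i = w i)
    (h : ∀ j, w j * (v j)⁻¹ ∈ Subgroup.normalClosure {v i}) : ACEquivalent v w := by
  classical
  -- One component is changed at a time; the `i`-th never moves, so its normal closure stays
  -- available.
  suffices H : ∀ s : Finset (Fin n), ACEquivalent v (s.piecewise w v) by
    simpa using H Finset.univ
  intro s
  induction s using Finset.induction_on with
  | empty => simpa using .refl _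
  | insert j s hj ih =>
    rw [Finset.piecewise_insert]
    by_cases hij : i = j
    · subst hij
      rw [← hi]
      convert ih using 1
      ext l
      by_cases hl : l = i
      · subst hl; simp [hj]
      · simp [hl]
    · refine ih.trans (acEquivalent_update _ _ ?_)
      have := normalClosure_singleton_le_othersClosure (s.piecewise w v) hij
      apply this
      have h1 : s.piecewise w v i = v i := by
        by_cases his : i ∈ s <;> simp [his, hi]
      rw [h1, Finset.piecewise_eq_of_notMem _ _ _ hj]
      exact h j

theorem ElementaryAC.map {H : Type*} [Group H] (f : G →* H) {v w : Fin n → G}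
    (h : ElementaryAC v w) : ElementaryAC (f ∘ v) (f ∘ w) := by
  cases h with
  | mul i j hij =>
    rw [Function.comp_update, map_mul]
    exact .mul (f ∘ v) i j hij
  | inv i =>
    rw [Function.comp_update, map_inv]
    exact .inv (f ∘ v) i
  | conj i g =>
    rw [Function.comp_update, map_mul, map_mul, map_inv]
    exact .conj (f ∘ v) i (f g)

theorem ACEquivalent.map {H : Type*} [Group H] (f : G →* H) {v w : Fin n → G}
    (h : ACEquivalent v w) : ACEquivalent (f ∘ v) (f ∘ w) := by
  induction h with
  | refl => exact .refl _
  | tail _ h ih => exact ih.trans (h.map f).equiv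

theorem ElementaryAC.cons (c : G) {v w : Fin n → G} (h : ElementaryAC v w) :
    ElementaryAC (Fin.cons c v : Fin (n + 1) → G) (Fin.cons c w) := by
  cases h with
  | mul i j hij =>
    simpa [Fin.cons_update] using
      ElementaryAC.mul (Fin.cons c v : Fin (n + 1) → G) i.succ j.succ (by simpa using hij)
  | inv i => simpa [Fin.cons_update] using ElementaryAC.inv (Fin.cons c v : Fin (n + 1) → G) i.succ
  | conj i g =>
    simpa [Fin.cons_update] using ElementaryAC.conj (Fin.cons c v : Fin (n + 1) → G) i.succ g

theorem ACEquivalent.cons (c : G) {v w : Fin n → G} (h : ACEquivalent v w) :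
    ACEquivalent (Fin.cons c v : Fin (n + 1) → G) (Fin.cons c w) := by
  induction h with
  | refl => exact .refl _
  | tail _ h ih => exact ih.trans (h.cons c).equiv

/-- An elementary transformation along a surjective homomorphism lifts, and the lift changes a
single component. -/
theorem ElementaryAC.exists_lift {H : Type*} [Group H] {f : G →* H}
    (hf : Function.Surjective f) {v : Fin n → H} {w : Fin n → H} (h : ElementaryAC v w) :
    ∃ i, ∀ x : Fin n → G, f ∘ x = v →
      ∃ c, ElementaryAC x (Function.update x i c) ∧ f ∘ Function.update x i c = w := by
  cases h with
  | mul i j hij =>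
    refine ⟨i, ?_⟩
    rintro x rfl
    exact ⟨_, .mul x i j hij, by rw [Function.comp_update, map_mul]; rfl⟩
  | inv i =>
    refine ⟨i, ?_⟩
    rintro x rfl
    exact ⟨_, .inv x i, by rw [Function.comp_update, map_inv]; rfl⟩
  | conj i g =>
    refine ⟨i, ?_⟩
    rintro x rfl
    obtain ⟨g, rfl⟩ := hf g
    exact ⟨_, .conj x i g, by rw [Function.comp_update, map_mul, map_mul, map_inv]; rfl⟩

theorem ACEquivalent.exists_lift {H : Type*} [Group H] {f : G →* H}
    (hf : Function.Surjective f) {x : Fin n → G} {w : Fin n → H} (h : ACEquivalent (f ∘ x) w) :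
    ∃ y, ACEquivalent x y ∧ f ∘ y = w := by
  induction h with
  | refl => exact ⟨x, .refl _, rfl⟩
  | tail _ h ih =>
    obtain ⟨y, hxy, hy⟩ := ih
    obtain ⟨i, hi⟩ := h.exists_lift hf
    obtain ⟨c, hc, hc'⟩ := hi y hy
    exact ⟨_, hxy.trans hc.equiv, hc'⟩

theorem ElementaryAC.normalClosure_le {v w : Fin n → G} (h : ElementaryAC v w) :
    Subgroup.normalClosure (Set.range w) ≤ Subgroup.normalClosure (Set.range v) := by
  have hv : ∀ l, v l ∈ Subgroup.normalClosure (Set.range v) :=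
    fun l => Subgroup.subset_normalClosure ⟨l, rfl⟩
  have key : ∀ i c, c ∈ Subgroup.normalClosure (Set.range v) →
      Subgroup.normalClosure (Set.range (Function.update v i c)) ≤
        Subgroup.normalClosure (Set.range v) := by
    intro i c hc
    refine Subgroup.normalClosure_le_normal ?_
    rintro _ ⟨l, rfl⟩
    by_cases hl : l = i
    · subst hl; simpa using hc
    · simpa [hl] using hv l
  cases h with
  | mul i j hij => exact key _ _ (mul_mem (hv _) (hv _))
  | inv i => exact key _ _ (inv_mem (hv _))
  | conj i g =>
    refine key _ _ ?_
    simpa using (Subgroup.normalClosure_normal (s := Set.range v)).conj_mem _ (hv i) g⁻¹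

theorem ACEquivalent.normalClosure_le {v w : Fin n → G} (h : ACEquivalent v w) :
    Subgroup.normalClosure (Set.range w) ≤ Subgroup.normalClosure (Set.range v) := by
  induction h with
  | refl => exact le_rfl
  | tail _ h ih => exact h.normalClosure_le.trans ih

theorem ACEquivalent.normallyGenerates {v w : Fin n → G} (h : ACEquivalent v w)
    (hv : NormallyGenerates v) : NormallyGenerates w :=
  top_le_iff.1 (hv.symm.le.trans h.symm.normalClosure_le)

theorem NormallyGenerates.map {H : Type*} [Group H] {f : G →* H} (hf : Function.Surjective f)
    {v : Fin n → G} (hv : NormallyGenerates v) : NormallyGenerates (f ∘ v) := by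
  unfold NormallyGenerates at *
  rw [Set.range_comp, ← Subgroup.map_normalClosure _ _ hf, hv, Subgroup.map_top_of_surjective _ hf]

end Moves

/-! ### Maximal normal subgroups with non-abelian quotient -/

section MaximalNormal

variable {H : Type*} [Group H]

theorem IsMaximalNormal.sup_eq_top {M N : Subgroup H} (hM : IsMaximalNormal M) [N.Normal]
    (h : ¬ N ≤ M) : N ⊔ M = ⊤ := by
  have := hM.1.1
  by_contra hne
  exact h (le_sup_left.trans (hM.2 ⟨inferInstance, hne⟩ le_sup_right))

/-- The maximal normal subgroups with non-abelian quotient. -/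
def IsNonabelianMaximalNormal (M : Subgroup H) : Prop :=
  IsMaximalNormal M ∧ ¬ commutator H ≤ M

/-- Primeness: otherwise both `N₁` and `N₂` map onto H/M, which would then be abelian. -/
theorem IsNonabelianMaximalNormal.le_or_le {M N₁ N₂ : Subgroup H}
    (hM : IsNonabelianMaximalNormal M) [N₁.Normal] [N₂.Normal] (h : ⁅N₁, N₂⁆ ≤ M) :
    N₁ ≤ M ∨ N₂ ≤ M := by
  by_contra! hne
  have hMn := hM.1.1.1
  apply hM.2
  have h1 : (⊤ : Subgroup (H ⧸ M)) = N₁.map (QuotientGroup.mk' M) := by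
    rw [← Subgroup.map_top_of_surjective _ (QuotientGroup.mk'_surjective M),
      ← hM.1.sup_eq_top hne.1, Subgroup.map_sup]
    simp
  have h2 : (⊤ : Subgroup (H ⧸ M)) = N₂.map (QuotientGroup.mk' M) := by
    rw [← Subgroup.map_top_of_surjective _ (QuotientGroup.mk'_surjective M),
      ← hM.1.sup_eq_top hne.2, Subgroup.map_sup]
    simp
  rw [commutator_def, ← QuotientGroup.ker_mk' M, ← MonoidHom.comap_bot,
    ← Subgroup.map_le_iff_le_comap,
    Subgroup.map_commutator, Subgroup.map_top_of_surjective _ (QuotientGroup.mk'_surjective M)]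
  conv_lhs => rw [h1]
  nth_rewrite 2 [← h1]
  rw [h2, ← Subgroup.map_commutator, Subgroup.map_le_iff_le_comap, MonoidHom.comap_bot,
    QuotientGroup.ker_mk']
  exact h

theorem IsNonabelianMaximalNormal.le_or_exists_le {M : Subgroup H}
    (hM : IsNonabelianMaximalNormal M) (F : Finset (Subgroup H)) (hF : ∀ N ∈ F, N.Normal)
    {L : Subgroup H} [L.Normal] (h : L ⊓ F.inf id ≤ M) : L ≤ M ∨ ∃ N ∈ F, N ≤ M := by
  classical
  induction F using Finset.induction_on generalizing L with
  | empty => simpa using h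
  | insert N F _ ih =>
    have hN := hF N (by simp)
    rw [Finset.inf_insert, id, ← inf_assoc] at h
    rcases ih (fun N hN => hF N (by simp [hN])) h with h | ⟨N', hN', h⟩
    · rcases hM.le_or_le ((Subgroup.commutator_le_inf _ _).trans h) with h | h
      · exact .inl h
      · exact .inr ⟨N, by simp, h⟩
    · exact .inr ⟨N', by simp [hN'], h⟩

/-- Induction gives L ∩ M ≤ N. If L ≰ M, primeness gives (N ∩ L)M = H; an element of L is then qm
with q ∈ N ∩ L, which forces m ∈ L ∩ M ≤ N. -/
theorem le_of_inf_le_of_not_le (F : Finset (Subgroup H))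
    (hF : ∀ M ∈ F, IsNonabelianMaximalNormal M) {N L : Subgroup H} [N.Normal] [L.Normal]
    (hN : ∀ M ∈ F, ¬ N ≤ M) (h : L ⊓ F.inf id ≤ N) : L ≤ N := by
  classical
  induction F using Finset.induction_on generalizing L with
  | empty => simpa using h
  | insert M F _ ih =>
    have hM := hF M (by simp)
    have hMn := hM.1.1.1
    rw [Finset.inf_insert, id, ← inf_assoc] at h
    have hLM : L ⊓ M ≤ N :=
      ih (fun M hM => hF M (by simp [hM])) (fun M hM => hN M (by simp [hM])) h
    by_cases hL : L ≤ M
    · rwa [inf_eq_left.2 hL] at hLM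
    have hQ : ¬ N ⊓ L ≤ M := fun hle =>
      (hM.le_or_le ((Subgroup.commutator_le_inf _ _).trans hle)).elim (hN M (by simp)) hL
    intro p hp
    have hp' : p ∈ (N ⊓ L) ⊔ M := by rw [hM.1.sup_eq_top hQ]; trivial
    obtain ⟨q, hq, m, hm, rfl⟩ := Subgroup.mem_sup_of_normal_right.1 hp'
    exact N.mul_mem hq.1 (hLM ⟨(L.mul_mem_cancel_left hq.2).1 hp, hm⟩)

/-- As in prime avoidance: a bad `k` is corrected by an element of L lying in all earlier members of
F but not in M. -/
theorem exists_mem_forall_mul_notMem (F : Finset (Subgroup H))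
    (hF : ∀ M ∈ F, IsNonabelianMaximalNormal M) {L : Subgroup H} [L.Normal]
    (hL : ∀ M ∈ F, ¬ L ≤ M) (x : H) : ∃ k ∈ L, ∀ M ∈ F, k * x ∉ M := by
  classical
  induction F using Finset.induction_on with
  | empty => exact ⟨1, L.one_mem, by simp⟩
  | insert M F hMF ih =>
    have hM := hF M (by simp)
    have hF' : ∀ M ∈ F, IsNonabelianMaximalNormal M := fun M hM => hF M (by simp [hM])
    obtain ⟨k, hk, hkx⟩ := ih hF' (fun M hM => hL M (by simp [hM]))
    by_cases hkM : k * x ∈ M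
    · have hp : ¬ L ⊓ F.inf id ≤ M := by
        intro hle
        rcases hM.le_or_exists_le F (fun N hN => (hF' N hN).1.1.1) hle with h | ⟨N, hN, h⟩
        · exact hL M (by simp) h
        · have : M = N := le_antisymm ((hF' N hN).1.2 hM.1.1 h) h
          exact hMF (this ▸ hN)
      obtain ⟨p, hp, hpM⟩ := SetLike.not_le_iff_exists.1 hp
      refine ⟨p * k, L.mul_mem hp.1 hk, ?_⟩
      intro N hN
      rw [mul_assoc]
      rcases Finset.mem_insert.1 hN with rfl | hN
      · rwa [Subgroup.mul_mem_cancel_right _ hkM]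
      · have hpN : p ∈ N := Finset.inf_le (f := id) hN hp.2
        rw [Subgroup.mul_mem_cancel_left _ hpN]
        exact hkx N hN
    · exact ⟨k, hk, by simpa [hkM] using hkx⟩

/-- The commutator subgroup of `H` embeds into a finite product of non-abelian simple quotients
of `H`. -/
def HasSemisimpleCommutator (H : Type*) [Group H] : Prop :=
  ∃ F : Finset (Subgroup H), (∀ M ∈ F, IsNonabelianMaximalNormal M) ∧
    commutator H ⊓ F.inf id = ⊥

theorem commutator_le_normalClosure {F : Finset (Subgroup H)}
    (hF : ∀ M ∈ F, IsNonabelianMaximalNormal M) (h : commutator H ⊓ F.inf id = ⊥) {x : H}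
    (hx : ∀ M ∈ F, x ∉ M) : commutator H ≤ Subgroup.normalClosure {x} :=
  le_of_inf_le_of_not_le F hF
    (fun M hM hle => hx M hM (hle (Subgroup.subset_normalClosure rfl))) (h.le.trans bot_le)

theorem HasSemisimpleCommutator.exists_mul (h : HasSemisimpleCommutator H) (x : H) :
    ∃ k ∈ commutator H, commutator H ≤ Subgroup.normalClosure {k * x} := by
  obtain ⟨F, hF, hF'⟩ := h
  obtain ⟨k, hk, hkx⟩ := exists_mem_forall_mul_notMem F hF (L := commutator H)
    (fun M hM => (hF M hM).2) x
  exact ⟨k, hk, commutator_le_normalClosure hF hF' hkx⟩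

/-- If M contains the other components, it misses `v i` because `v` normally generates; the
remaining M are avoided by a multiplier from `othersClosure v i`. -/
theorem HasSemisimpleCommutator.exists_acEquivalent (h : HasSemisimpleCommutator H) {n : ℕ}
    (v : Fin n → H) (hv : NormallyGenerates v) (i : Fin n) :
    ∃ w, ACEquivalent v w ∧ commutator H ≤ Subgroup.normalClosure {w i} := by
  classical
  obtain ⟨F, hF, hF'⟩ := h
  obtain ⟨k, hk, hkx⟩ := exists_mem_forall_mul_notMem
    (F.filter fun M => ¬ othersClosure v i ≤ M)
    (fun M hM => hF M (Finset.mem_filter.1 hM).1)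
    (L := othersClosure v i) (fun M hM => (Finset.mem_filter.1 hM).2) (v i)
  refine ⟨_, acEquivalent_update v i (h := k * v i) (by simpa using hk), ?_⟩
  rw [Function.update_self]
  refine commutator_le_normalClosure hF hF' fun M hM => ?_
  by_cases hle : othersClosure v i ≤ M
  · rw [Subgroup.mul_mem_cancel_left _ (hle hk)]
    intro hvi
    have := (hF M hM).1.1.1
    apply (hF M hM).1.1.2
    rw [← top_le_iff, ← hv]
    refine Subgroup.normalClosure_le_normal ?_
    rintro _ ⟨j, rfl⟩
    by_cases hj : j = i
    · exact hj ▸ hvi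
    · exact hle (mem_othersClosure v hj)
  · exact hkx M (by simp [hM, hle])

/-! ### Reduction to the abelianization -/

section Lift

variable {n : ℕ}

theorem exists_normalClosure_of_normalClosure {K : Subgroup H} [K.Normal]
    (hK : ∀ x : H, ∃ k ∈ K, K ≤ Subgroup.normalClosure {k * x}) {x : Fin n → H} {i : Fin n}
    (hi : K ≤ Subgroup.normalClosure {x i}) (j : Fin n) :
    ∃ z, ACEquivalent x z ∧ QuotientGroup.mk' K ∘ z = QuotientGroup.mk' K ∘ x ∧
      K ≤ Subgroup.normalClosure {z j} := by
  by_cases hij : i = j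
  · exact ⟨x, .refl _, rfl, hij ▸ hi⟩
  obtain ⟨k, hk, hkx⟩ := hK (x j)
  refine ⟨Function.update x j (k * x j), acEquivalent_update _ _ ?_, ?_, by simpa using hkx⟩
  · simpa using normalClosure_singleton_le_othersClosure x hij (hi hk)
  · have hk1 : QuotientGroup.mk' K k = 1 := (QuotientGroup.eq_one_iff k).2 hk
    rw [Function.comp_update, map_mul, hk1, one_mul]
    exact Function.update_eq_self j (QuotientGroup.mk' K ∘ x)

variable [Nontrivial (Fin n)]

/-- A second slot `i` is made to absorb K and used to set slot `j` to `y j`; that slot absorbs K too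
and corrects all the others. -/
theorem acEquivalent_of_normalClosure_of_eq {K : Subgroup H} [K.Normal]
    (hK : ∀ x : H, ∃ k ∈ K, K ≤ Subgroup.normalClosure {k * x}) {x y : Fin n → H} {j : Fin n}
    (hx : K ≤ Subgroup.normalClosure {x j}) (hy : K ≤ Subgroup.normalClosure {y j})
    (hxy : QuotientGroup.mk' K ∘ x = QuotientGroup.mk' K ∘ y) : ACEquivalent x y := by
  obtain ⟨i, hij⟩ := exists_ne j
  obtain ⟨z, hxz, hzx, hz⟩ := exists_normalClosure_of_normalClosure hK hx i
  have hmem : ∀ l, y l * (z l)⁻¹ ∈ K := fun l => by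
    have := congr_fun (hzx.trans hxy) l
    have h2 : QuotientGroup.mk' K (y l * (z l)⁻¹) = 1 := by
      rw [map_mul, map_inv, mul_inv_eq_one]; exact this.symm
    exact (QuotientGroup.eq_one_iff _).1 h2
  refine hxz.trans ((acEquivalent_update z j (h := y j) ?_).trans
    (acEquivalent_of_normalClosure j (by simp) fun l => ?_))
  · exact normalClosure_singleton_le_othersClosure z hij (hz (hmem j))
  · rw [Function.update_self]
    apply hy
    by_cases hl : l = j
    · subst hl; simp
    · simpa [hl] using hmem l

theorem exists_lift_normalClosure {K : Subgroup H} [K.Normal]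
    (hK : ∀ x : H, ∃ k ∈ K, K ≤ Subgroup.normalClosure {k * x}) {x : Fin n → H}
    {w : Fin n → H ⧸ K} (hx : ∃ i, K ≤ Subgroup.normalClosure {x i})
    (h : ACEquivalent (QuotientGroup.mk' K ∘ x) w) :
    ∃ y, ACEquivalent x y ∧ QuotientGroup.mk' K ∘ y = w ∧
      ∃ i, K ≤ Subgroup.normalClosure {y i} := by
  induction h with
  | refl => exact ⟨x, .refl _, rfl, hx⟩
  | tail _ h ih =>
    obtain ⟨y, hxy, hy, l, hl⟩ := ih
    obtain ⟨i, hi⟩ := h.exists_lift (QuotientGroup.mk'_surjective K)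
    -- The absorbing component is shifted away from the slot `i` that the lifted move alters.
    obtain ⟨j, hij⟩ := exists_ne i
    obtain ⟨z, hyz, hzy, hz⟩ := exists_normalClosure_of_normalClosure hK hl j
    obtain ⟨c, hc, hc'⟩ := hi z (hzy.trans hy)
    exact ⟨_, hxy.trans (hyz.trans hc.equiv), hc', j, by simpa [hij] using hz⟩

theorem HasSemisimpleCommutator.acEquivalent (h : HasSemisimpleCommutator H)
    (hab : ∀ v w : Fin n → Abelianization H, NormallyGenerates v → NormallyGenerates w →
      ACEquivalent v w) {v w : Fin n → H} (hv : NormallyGenerates v) (hw : NormallyGenerates w) :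
    ACEquivalent v w := by
  obtain ⟨i, -⟩ := exists_pair_ne (Fin n)
  obtain ⟨v', hvv', hv'⟩ := h.exists_acEquivalent v hv i
  obtain ⟨w', hww', hw'⟩ := h.exists_acEquivalent w hw i
  have hab' := hab (QuotientGroup.mk' (commutator H) ∘ v') (QuotientGroup.mk' (commutator H) ∘ w')
    ((hvv'.normallyGenerates hv).map (QuotientGroup.mk'_surjective _))
    ((hww'.normallyGenerates hw).map (QuotientGroup.mk'_surjective _))
  obtain ⟨y, hy, hyw, l, hl⟩ := exists_lift_normalClosure h.exists_mul ⟨i, hv'⟩ hab'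
  obtain ⟨z, hyz, hzy, hz⟩ := exists_normalClosure_of_normalClosure h.exists_mul hl i
  exact ((hvv'.trans hy).trans hyz).trans ((acEquivalent_of_normalClosure_of_eq h.exists_mul
    hz hw' (hzy.trans hyw)).trans hww'.symm)

end Lift

end MaximalNormal

/-! ### Finitely generated abelian groups -/

section Abelian

variable {A : Type*} [CommGroup A]

theorem normalClosure_eq_closure (s : Set A) :
    Subgroup.normalClosure s = Subgroup.closure s :=
  le_antisymm (Subgroup.normalClosure_le_normal Subgroup.subset_closure)
    Subgroup.closure_le_normalClosure

theorem normallyGenerates_iff_closure {n : ℕ} {v : Fin n → A} :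
    NormallyGenerates v ↔ Subgroup.closure (Set.range v) = ⊤ := by
  rw [NormallyGenerates, normalClosure_eq_closure]

/-- Every finite abelian group has a cyclic quotient of the same exponent. -/
theorem exists_cyclic_quotient_of_finite (A : Type*) [CommGroup A] [Finite A] :
    ∃ (C : Type) (_ : CommGroup C) (_ : IsCyclic C) (f : A →* C), Function.Surjective f ∧
      ∀ k : ℤ, (∀ c : C, c ^ k = 1) → ∀ a : A, a ^ k = 1 := by
  have : NeZero (Monoid.exponent A) := ⟨Monoid.exponent_ne_zero_of_finite⟩
  -- The dual group is isomorphic to A, so some character has order the exponent of A; its image, a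
  -- finite subgroup of ℂˣ, is the cyclic quotient.
  obtain ⟨e⟩ := CommGroup.monoidHom_mulEquiv_of_hasEnoughRootsOfUnity A ℂ
  have : Finite (A →* ℂˣ) := Finite.of_equiv _ e.symm.toEquiv
  obtain ⟨χ, hχ⟩ := Monoid.exists_orderOf_eq_exponent
    (Monoid.ExponentExists.of_finite (G := A →* ℂˣ))
  rw [Monoid.exponent_eq_of_mulEquiv e] at hχ
  have : Finite χ.range := Finite.of_surjective _ χ.rangeRestrict_surjective
  refine ⟨χ.range, inferInstance, inferInstance, χ.rangeRestrict, χ.rangeRestrict_surjective, ?_⟩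
  intro k hk a
  have h1 : χ ^ k = 1 := by
    ext a
    have := congr_arg (fun x : χ.range => ((x : ℂˣ) : ℂ)) (hk (χ.rangeRestrict a))
    simpa using this
  have h2 : (orderOf a : ℤ) ∣ k :=
    (Int.natCast_dvd_natCast.2 (hχ ▸ Monoid.order_dvd_exponent a)).trans
      (orderOf_dvd_iff_zpow_eq_one.2 h1)
  exact orderOf_dvd_iff_zpow_eq_one.1 h2

/-- Every finitely generated abelian group has a cyclic quotient of the same exponent. -/
theorem exists_cyclic_quotient (A : Type*) [CommGroup A] [Group.FG A] :
    ∃ (C : Type) (_ : CommGroup C) (_ : IsCyclic C) (f : A →* C), Function.Surjective f ∧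
      ∀ k : ℤ, (∀ c : C, c ^ k = 1) → ∀ a : A, a ^ k = 1 := by
  obtain ⟨ι, j, _, _, p, hp, e, ⟨E⟩⟩ := CommGroup.equiv_free_prod_prod_multiplicative_zmod A
  rcases isEmpty_or_nonempty j with hj | ⟨⟨l⟩⟩
  · have (i : ι) : NeZero (p i ^ e i) := ⟨pow_ne_zero _ (hp i).ne_zero⟩
    have (i : ι) : Finite (Multiplicative (ZMod (p i ^ e i))) :=
      inferInstanceAs (Finite (ZMod (p i ^ e i)))
    have : Finite A := Finite.of_equiv _ E.symm.toEquiv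
    exact exists_cyclic_quotient_of_finite A
  · refine ⟨Multiplicative ℤ, inferInstance, inferInstance,
      (Pi.evalMonoidHom _ l).comp ((MonoidHom.fst _ _).comp E.toMonoidHom), ?_, ?_⟩
    · refine (Function.surjective_eval l).comp (Prod.fst_surjective.comp E.surjective)
    · intro k hk
      have := congr_arg Multiplicative.toAdd (hk (Multiplicative.ofAdd 1))
      have hk0 : k = 0 := by simpa using this
      simp [hk0]

/-- Euclid's algorithm: a nonzero entry of least absolute value over the whole AC-class divides the
other entries of its vector. -/
theorem exists_acEquivalent_update_one_int {n : ℕ} (e : Fin (n + 1) → Multiplicative ℤ) :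
    ∃ i x, ACEquivalent e (Function.update 1 i x) := by
  by_cases he : e = 1
  · exact ⟨0, 1, by simpa [he] using .refl _⟩
  obtain ⟨i₀, hi₀⟩ := Function.ne_iff.1 he
  obtain ⟨⟨x, i⟩, ⟨hx, hxi⟩, hmin⟩ :=
    (measure fun p : (Fin (n + 1) → Multiplicative ℤ) × Fin (n + 1) =>
      (p.1 p.2).toAdd.natAbs).wf.has_min {p | ACEquivalent e p.1 ∧ p.1 p.2 ≠ 1}
    ⟨(e, i₀), .refl _, hi₀⟩
  change ACEquivalent e x at hx
  change x i ≠ 1 at hxi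
  replace hmin : ∀ y j, ACEquivalent e y → y j ≠ 1 →
      ¬ (y j).toAdd.natAbs < (x i).toAdd.natAbs := fun y j h h' => hmin (y, j) ⟨h, h'⟩
  have hxi0 : (x i).toAdd ≠ 0 := fun h => hxi (by simpa using h)
  have hdvd : ∀ j, (x i).toAdd ∣ (x j).toAdd := by
    intro j
    by_cases hij : i = j
    · rw [hij]
    by_contra hnd
    have hmod : (x j).toAdd % (x i).toAdd ≠ 0 := fun h => hnd (Int.dvd_of_emod_eq_zero h)
    have hxj : x j = x i ^ ((x j).toAdd / (x i).toAdd) *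
        Multiplicative.ofAdd ((x j).toAdd % (x i).toAdd) := by
      apply Multiplicative.toAdd.injective
      simp only [toAdd_mul, toAdd_zpow, toAdd_ofAdd, smul_eq_mul]
      rw [mul_comm, Int.mul_ediv_add_emod]
    have h1 := acEquivalent_update x j
      (h := Multiplicative.ofAdd ((x j).toAdd % (x i).toAdd)) (by
        have : Multiplicative.ofAdd ((x j).toAdd % (x i).toAdd) * (x j)⁻¹ =
            (x i ^ ((x j).toAdd / (x i).toAdd))⁻¹ := by
          conv_lhs => rw [hxj]
          simp
        rw [this]
        exact inv_mem (zpow_mem (mem_othersClosure x hij) _))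
    refine hmin _ j (hx.trans h1) ?_ ?_
    · rw [Function.update_self]
      exact fun h => hmod (by simpa using h)
    · rw [Function.update_self, toAdd_ofAdd]
      have h1 := Int.emod_nonneg (x j).toAdd hxi0
      have h2 := Int.emod_lt_abs (x j).toAdd hxi0
      rw [← Int.ofNat_lt, Int.natCast_natAbs, Int.natCast_natAbs, abs_of_nonneg h1]
      exact h2
  refine ⟨i, x i, hx.trans (acEquivalent_of_normalClosure i (by simp) fun j => ?_)⟩
  by_cases hj : j = i
  · subst hj; simp
  · obtain ⟨c, hc⟩ := hdvd j
    have : x j = x i ^ c := by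
      apply Multiplicative.toAdd.injective
      simp [hc, mul_comm]
    rw [Function.update_of_ne hj, Pi.one_apply, one_mul, this]
    exact inv_mem (zpow_mem (Subgroup.subset_normalClosure (Set.mem_singleton _)) _)

theorem exists_acEquivalent_update_one {C : Type*} [CommGroup C] [IsCyclic C] {n : ℕ}
    (v : Fin (n + 1) → C) : ∃ i x, ACEquivalent v (Function.update 1 i x) := by
  obtain ⟨g, hg⟩ := IsCyclic.exists_generator (α := C)
  choose e he using fun i => Subgroup.mem_zpowers_iff.1 (hg (v i))
  obtain ⟨i, x, h⟩ := exists_acEquivalent_update_one_int fun i => Multiplicative.ofAdd (e i)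
  refine ⟨i, zpowersHom C g x, ?_⟩
  convert h.map (zpowersHom C g) using 1
  · ext i; simp [he]
  · rw [Function.comp_update]
    congr 1
    ext; simp

theorem normalClosure_singleton_of_update_one {G : Type*} [Group G] {n : ℕ} {i : Fin n} {x : G}
    (h : NormallyGenerates (Function.update 1 i x)) : Subgroup.normalClosure {x} = ⊤ := by
  rw [← top_le_iff, ← h]
  refine Subgroup.normalClosure_le_normal ?_
  rintro _ ⟨j, rfl⟩
  by_cases hj : j = i
  · subst hj
    rw [Function.update_self]
    exact Subgroup.subset_normalClosure rfl
  · simp [hj]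

theorem acEquivalent_update_one_of_generates {C : Type*} [CommGroup C] [IsCyclic C] {n : ℕ}
    (v : Fin (n + 2) → C) (hv : NormallyGenerates v) {t : C} (ht : ∀ c, c ∈ Subgroup.zpowers t) :
    ACEquivalent v (Function.update 1 0 t) := by
  obtain ⟨i, x, h⟩ := exists_acEquivalent_update_one v
  have htop := normalClosure_singleton_of_update_one (h.normallyGenerates hv)
  have httop : Subgroup.normalClosure {t} = ⊤ := by
    rw [normalClosure_eq_closure, ← Subgroup.zpowers_eq_closure]
    exact (Subgroup.eq_top_iff' _).2 ht
  have key : ∀ {a b : C} {j k : Fin (n + 2)}, Subgroup.normalClosure {a} = ⊤ → k ≠ j →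
      ACEquivalent (Function.update (1 : Fin (n + 2) → C) j a)
        (Function.update (Function.update 1 j a) k b) := by
    intro a b j k ha hk
    refine acEquivalent_update _ k
      (normalClosure_singleton_le_othersClosure (Function.update 1 j a) hk.symm ?_)
    rw [Function.update_self, ha]
    trivial
  have key2 : ∀ {a b : C} {j k : Fin (n + 2)}, Subgroup.normalClosure {a} = ⊤ →
      Subgroup.normalClosure {b} = ⊤ → k ≠ j →
      ACEquivalent (Function.update (1 : Fin (n + 2) → C) j a) (Function.update 1 k b) := by
    intro a b j k ha hb hk
    refine (key (b := b) ha hk).trans ?_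
    rw [Function.update_comm hk.symm]
    exact (key hb hk.symm).symm
  by_cases hi : i = 0
  · subst hi
    -- A generator can be exchanged only across two slots, hence the detour through slot 1.
    exact h.trans ((key2 (k := 1) htop httop (by simp)).trans (key2 httop httop (by simp)))
  · exact h.trans (key2 htop httop (Ne.symm hi))

theorem exists_acEquivalent_update_one_zero {C : Type*} [CommGroup C] [IsCyclic C] {n : ℕ}
    (v : Fin (n + 1) → C) (hv : NormallyGenerates v) :
    ∃ t, (∀ c, c ∈ Subgroup.zpowers t) ∧ ACEquivalent v (Function.update 1 0 t) := by
  cases n with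
  | zero =>
    obtain ⟨i, x, h⟩ := exists_acEquivalent_update_one v
    have htop := normalClosure_singleton_of_update_one (h.normallyGenerates hv)
    rw [normalClosure_eq_closure, ← Subgroup.zpowers_eq_closure, Subgroup.eq_top_iff'] at htop
    have hi : i = 0 := by omega
    exact ⟨x, htop, hi ▸ h⟩
  | succ n =>
    obtain ⟨t, ht⟩ := IsCyclic.exists_generator (α := C)
    exact ⟨t, ht, acEquivalent_update_one_of_generates v hv ht⟩

/-- Write b ∈ ker f as t^k β with β generated by `y`. Then f(t)^k = 1, so k kills C, and by the
exponent condition t^k = 1. -/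
theorem normallyGenerates_ker {C : Type*} [CommGroup C] {f : A →* C}
    (hC : ∀ k : ℤ, (∀ c : C, c ^ k = 1) → ∀ a : A, a ^ k = 1)
    {n : ℕ} {t : A} {y : Fin n → f.ker} (ht : ∀ c, c ∈ Subgroup.zpowers (f t))
    (h : NormallyGenerates (Fin.cons t (fun i => (y i : A)) : Fin (n + 1) → A)) :
    NormallyGenerates y := by
  rw [normallyGenerates_iff_closure] at h ⊢
  rw [eq_top_iff]
  rintro ⟨b, hb⟩ -
  have hb' : b ∈ Subgroup.closure
      (Set.range (Fin.cons t (fun i => (y i : A)) : Fin (n + 1) → A)) := by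
    rw [h]; trivial
  rw [Fin.range_cons, Set.insert_eq, Subgroup.closure_union, ← Subgroup.zpowers_eq_closure,
    Subgroup.mem_sup] at hb'
  obtain ⟨_, ⟨k, rfl⟩, β, hβ, hkβ⟩ := hb'
  have hr : Set.range (fun i => (y i : A)) = f.ker.subtype '' Set.range y := by
    rw [← Set.range_comp]; rfl
  rw [hr, ← MonoidHom.map_closure] at hβ
  obtain ⟨β, hβ, rfl⟩ := hβ
  have hk : f t ^ k = 1 := by
    have := congr_arg f hkβ
    simpa [MonoidHom.mem_ker.1 hb, MonoidHom.mem_ker.1 β.2] using this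
  have hk' := hC k (fun c => by
    obtain ⟨l, rfl⟩ := ht c
    change (f t ^ l) ^ k = 1
    rw [zpow_comm, hk, one_zpow]) t
  simp only [hk', one_mul] at hkβ
  have hb'' : (⟨b, hb⟩ : f.ker) = β := Subtype.ext hkβ.symm
  rw [hb'']
  exact hβ

theorem exists_acEquivalent_cons {C : Type*} [CommGroup C] [IsCyclic C] {f : A →* C}
    (hf : Function.Surjective f) {n : ℕ} {v : Fin (n + 1) → A}
    {c : C} (h : ACEquivalent (f ∘ v) (Function.update 1 0 c)) :
    ∃ t : A, f t = c ∧ ∃ y : Fin n → f.ker, ACEquivalent v (Fin.cons t (fun i => (y i : A))) := by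
  obtain ⟨y, hvy, hy⟩ := h.exists_lift hf
  refine ⟨y 0, by simpa using congr_fun hy 0, fun i => ⟨y i.succ, ?_⟩, ?_⟩
  · simpa using congr_fun hy i.succ
  · convert hvy
    exact Fin.cons_self_tail y

theorem acEquivalent_of_commGroup {m : ℕ} {A : Type*} [CommGroup A] {u : Fin m → A}
    (hu : NormallyGenerates u) {v w : Fin (m + 1) → A} (hv : NormallyGenerates v)
    (hw : NormallyGenerates w) : ACEquivalent v w := by
  induction m generalizing A with
  | zero =>
    have : Subsingleton A := by
      rw [← Subgroup.subsingleton_iff, ← subsingleton_iff_bot_eq_top, ← hu]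
      simp
    rw [Subsingleton.elim v w]
    exact .refl _
  | succ m ih =>
    have : Group.FG A := Group.fg_iff.2
      ⟨_, normallyGenerates_iff_closure.1 hu, Set.finite_range u⟩
    obtain ⟨C, _, _, f, hf, hC⟩ := exists_cyclic_quotient A
    obtain ⟨g, hg⟩ := IsCyclic.exists_generator (α := C)
    -- `u` may have a single component, so its generator cannot be prescribed; `v` and `w` have at
    -- least two and both reach `g`.
    obtain ⟨g', hg', hu'⟩ := exists_acEquivalent_update_one_zero (f ∘ u) (hu.map hf)
    obtain ⟨t, rfl, x, hx⟩ := exists_acEquivalent_cons hf hu'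
    obtain ⟨a, rfl, y, hy⟩ := exists_acEquivalent_cons hf
      (acEquivalent_update_one_of_generates (f ∘ v) (hv.map hf) hg)
    obtain ⟨b, hab, z, hz⟩ := exists_acEquivalent_cons hf
      (acEquivalent_update_one_of_generates (f ∘ w) (hw.map hf) hg)
    have hxg := normallyGenerates_ker hC hg' (hx.normallyGenerates hu)
    have hyg := normallyGenerates_ker hC hg (hy.normallyGenerates hv)
    have hzg := normallyGenerates_ker hC (hab ▸ hg) (hz.normallyGenerates hw)
    have hyz := ((ih hxg hyg hzg).map f.ker.subtype).cons a
    have hker : b * a⁻¹ ∈ f.ker := by rw [MonoidHom.mem_ker, map_mul, map_inv, hab, mul_inv_cancel]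
    have hfin : ACEquivalent (Fin.cons a (f.ker.subtype ∘ z) : Fin (m + 2) → A)
        (Function.update (Fin.cons a (f.ker.subtype ∘ z)) 0 b) := by
      refine acEquivalent_update _ 0 ?_
      have hle : f.ker ≤ othersClosure (Fin.cons a (f.ker.subtype ∘ z) : Fin (m + 2) → A) 0 := by
        have hmap : f.ker = (Subgroup.closure (Set.range z)).map f.ker.subtype := by
          rw [normallyGenerates_iff_closure.1 hzg, ← MonoidHom.range_eq_map,
            Subgroup.range_subtype]
        refine hmap.le.trans ?_
        rw [MonoidHom.map_closure, Subgroup.closure_le]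
        rintro _ ⟨_, ⟨i, rfl⟩, rfl⟩
        simpa using mem_othersClosure (Fin.cons a (f.ker.subtype ∘ z) : Fin (m + 2) → A)
          (Fin.succ_ne_zero i)
      exact hle hker
    rw [Fin.update_cons_zero] at hfin
    exact hy.trans (hyz.trans (hfin.trans hz.symm))

end Abelian

/-! ### Lifting from G/W(G) to G -/

section Frattini

theorem exists_isMaximalNormal_ge {G : Type*} [Group G] [Group.FG G] {N : Subgroup G}
    (hN : N.Normal) (hne : N ≠ ⊤) : ∃ M, N ≤ M ∧ IsMaximalNormal M := by
  refine zorn_le_nonempty₀ {N : Subgroup G | N.Normal ∧ N ≠ ⊤} ?_ N ⟨hN, hne⟩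
  intro c hc hchain N₀ hN₀
  have hdir : DirectedOn (· ≤ ·) c := hchain.directedOn
  refine ⟨sSup c, ⟨⟨fun x hx g => ?_⟩, fun htop => ?_⟩, fun M hM => le_sSup hM⟩
  · obtain ⟨M, hM, hxM⟩ := (Subgroup.mem_sSup_of_directedOn ⟨N₀, hN₀⟩ hdir).1 hx
    exact (Subgroup.mem_sSup_of_directedOn ⟨N₀, hN₀⟩ hdir).2 ⟨M, hM, (hc hM).1.conj_mem x hxM g⟩
  · obtain ⟨s, hs⟩ := Group.fg_def.1 (inferInstance : Group.FG G)
    have hsub : ∃ M ∈ c, (s : Set G) ⊆ M := by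
      have : (s : Set G) ⊆ ⋃ M ∈ c, (M : Set G) := fun x _ => by
        have hx : x ∈ sSup c := htop ▸ Subgroup.mem_top x
        simpa using (Subgroup.mem_sSup_of_directedOn ⟨N₀, hN₀⟩ hdir).1 hx
      exact DirectedOn.exists_mem_subset_of_finset_subset_biUnion ⟨N₀, hN₀⟩ hdir this
    obtain ⟨M, hM, hsM⟩ := hsub
    exact (hc hM).2 (top_le_iff.1 (hs ▸ (Subgroup.closure_le M).2 hsM))

/-- A proper N would lie in a maximal normal subgroup, which contains W(G) and hence all of `u`. -/
theorem eq_top_of_forall_exists_mem {G : Type*} [Group G] [Group.FG G] {N : Subgroup G}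
    (hN : N.Normal) {m : ℕ} {u : Fin m → G} (hu : NormallyGenerates u)
    (h : ∀ l, ∃ a ∈ N, QuotientGroup.mk' (nFrattini G) a = QuotientGroup.mk' (nFrattini G) (u l)) :
    N = ⊤ := by
  by_contra hne
  obtain ⟨M, hNM, hM⟩ := exists_isMaximalNormal_ge hN hne
  have := hM.1.1
  apply hM.1.2
  rw [← top_le_iff, ← hu]
  refine Subgroup.normalClosure_le_normal ?_
  rintro _ ⟨l, rfl⟩
  obtain ⟨a, ha, hal⟩ := h l
  have hW : a⁻¹ * u l ∈ M :=
    Subgroup.mem_sInf.1 (QuotientGroup.eq.1 hal : a⁻¹ * u l ∈ nFrattini G) M hM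
  exact (M.mul_mem_cancel_left (inv_mem (hNM ha))).1 hW

theorem acEquivalent_update_of_eq_top {G : Type*} [Group G] {n : ℕ} {v : Fin n → G} {i : Fin n}
    (h : othersClosure v i = ⊤) (x : G) : ACEquivalent v (Function.update v i x) :=
  acEquivalent_update v i (h ▸ Subgroup.mem_top _)

theorem acEquivalent_cons_cons {G : Type*} [Group G] [Group.FG G] {m : ℕ} {u x : Fin m → G}
    (hu : NormallyGenerates u)
    (hxu : QuotientGroup.mk' (nFrattini G) ∘ x = QuotientGroup.mk' (nFrattini G) ∘ u) (g h : G) :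
    ACEquivalent (Fin.cons g x : Fin (m + 1) → G) (Fin.cons h x) := by
  have := acEquivalent_update_of_eq_top (v := (Fin.cons g x : Fin (m + 1) → G)) (i := 0)
    (eq_top_of_forall_exists_mem inferInstance hu fun l => ⟨x l, ?_, congr_fun hxu l⟩) h
  · rwa [Fin.update_cons_zero] at this
  · simpa using mem_othersClosure (Fin.cons g x : Fin (m + 1) → G) (Fin.succ_ne_zero l)

/-- The spare slot is set to `u j`, which makes slot `j` redundant; once that slot is `u j`, the
spare slot is reset to `g`. -/
theorem acEquivalent_cons_update {G : Type*} [Group G] [Group.FG G] {m : ℕ} {u x : Fin m → G}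
    (hu : NormallyGenerates u)
    (hxu : QuotientGroup.mk' (nFrattini G) ∘ x = QuotientGroup.mk' (nFrattini G) ∘ u) (g : G)
    (j : Fin m) :
    ACEquivalent (Fin.cons g x : Fin (m + 1) → G) (Fin.cons g (Function.update x j (u j))) := by
  have hxu' : QuotientGroup.mk' (nFrattini G) ∘ Function.update x j (u j) =
      QuotientGroup.mk' (nFrattini G) ∘ u := by
    rw [Function.comp_update, hxu]
    exact Function.update_eq_self j (QuotientGroup.mk' (nFrattini G) ∘ u)
  refine (acEquivalent_cons_cons hu hxu g (u j)).trans
    (.trans ?_ (acEquivalent_cons_cons hu hxu' (u j) g))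
  rw [Fin.cons_update]
  refine acEquivalent_update_of_eq_top (eq_top_of_forall_exists_mem inferInstance hu fun l => ?_) _
  by_cases hl : l = j
  · subst hl
    refine ⟨u l, ?_, rfl⟩
    simpa using mem_othersClosure (Fin.cons (u l) x : Fin (m + 1) → G) (Fin.succ_ne_zero l).symm
  · refine ⟨x l, ?_, congr_fun hxu l⟩
    simpa using mem_othersClosure (Fin.cons (u j) x : Fin (m + 1) → G) (i := j.succ) (j := l.succ)
      (by simpa using hl)

theorem acEquivalent_cons_of_eq {G : Type*} [Group G] [Group.FG G] {m : ℕ} {u x : Fin m → G}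
    (hu : NormallyGenerates u)
    (hxu : QuotientGroup.mk' (nFrattini G) ∘ x = QuotientGroup.mk' (nFrattini G) ∘ u) (g h : G) :
    ACEquivalent (Fin.cons g x : Fin (m + 1) → G) (Fin.cons h u) := by
  classical
  suffices H : ∀ s : Finset (Fin m),
      ACEquivalent (Fin.cons g x : Fin (m + 1) → G) (Fin.cons g (s.piecewise u x)) by
    have := H Finset.univ
    rw [Finset.piecewise_univ] at this
    exact this.trans (acEquivalent_cons_cons hu rfl g h)
  intro s
  induction s using Finset.induction_on with
  | empty => simpa using .refl _
  | insert j s hj ih =>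
    rw [Finset.piecewise_insert]
    refine ih.trans (acEquivalent_cons_update hu ?_ g j)
    ext l
    by_cases hl : l ∈ s
    · simp [hl]
    · simpa [hl] using congr_fun hxu l

end Frattini

/-! ### The three cases of the class 𝒲 -/

section ClassW

theorem IsMaximalNormal.map_mk {G : Type*} [Group G] {M : Subgroup G} (hM : IsMaximalNormal M) :
    IsMaximalNormal (M.map (QuotientGroup.mk' (nFrattini G))) := by
  have hMn := hM.1.1
  have hW : nFrattini G ≤ M := sInf_le hM
  have hq := QuotientGroup.mk'_surjective (nFrattini G)
  have hcomap : (M.map (QuotientGroup.mk' (nFrattini G))).comap (QuotientGroup.mk' (nFrattini G))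
      = M := by
    rw [Subgroup.comap_map_eq, QuotientGroup.ker_mk', sup_eq_left.2 hW]
  refine ⟨⟨hMn.map _ hq, fun h => hM.1.2 ?_⟩, fun N hN hle => ?_⟩
  · rw [← hcomap, h, Subgroup.comap_top]
  · have hNn := hN.1
    rw [← Subgroup.map_comap_eq_self_of_surjective hq N]
    refine Subgroup.map_mono (hM.2 ⟨inferInstance, fun h => hN.2 ?_⟩
      (Subgroup.map_le_iff_le_comap.1 hle))
    rw [← Subgroup.map_comap_eq_self_of_surjective hq N, h, Subgroup.map_top_of_surjective _ hq]

theorem nFrattini_quotient_nFrattini (G : Type*) [Group G] :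
    nFrattini (G ⧸ nFrattini G) = ⊥ := by
  rw [eq_bot_iff]
  intro x hx
  obtain ⟨g, rfl⟩ := QuotientGroup.mk'_surjective (nFrattini G) x
  refine (QuotientGroup.eq_one_iff g).2 (Subgroup.mem_sInf.2 fun M hM => ?_)
  have hW : nFrattini G ≤ M := sInf_le hM
  have h : g ∈ (M.map (QuotientGroup.mk' (nFrattini G))).comap
    (QuotientGroup.mk' (nFrattini G)) := Subgroup.mem_sInf.1 hx _ (IsMaximalNormal.map_mk hM)
  rwa [Subgroup.comap_map_eq, QuotientGroup.ker_mk', sup_eq_left.2 hW] at h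

/-- Take all maximal normal subgroups with non-abelian quotient; the others contain the commutator
subgroup, so the intersection lies in W(H). -/
theorem HasSemisimpleCommutator.of_finite {H : Type*} [Group H] [Finite H]
    (h : nFrattini H = ⊥) : HasSemisimpleCommutator H := by
  refine ⟨(Set.toFinite {M : Subgroup H | IsNonabelianMaximalNormal M}).toFinset,
    fun M hM => by simpa using hM, ?_⟩
  rw [eq_bot_iff, ← h]
  refine le_sInf fun M hM => ?_
  by_cases hK : commutator H ≤ M
  · exact inf_le_left.trans hK
  · exact inf_le_right.trans (Finset.inf_le (f := id)
      ((Set.Finite.mem_toFinset _).2 ⟨hM, hK⟩))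

theorem HasSemisimpleCommutator.of_comm {H : Type*} [Group H] (h : ∀ a b : H, a * b = b * a) :
    HasSemisimpleCommutator H := by
  refine ⟨∅, by simp, ?_⟩
  rw [eq_bot_iff, commutator_def]
  refine inf_le_left.trans (Subgroup.commutator_le.2 fun a _ b _ => ?_)
  rw [Subgroup.mem_bot, commutatorElement_eq_one_iff_mul_comm]
  exact h a b

theorem isNonabelianMaximalNormal_ker {H S : Type*} [Group H] [Group S] [IsSimpleGroup S]
    (hS : ¬ ∀ a b : S, a * b = b * a) {f : H →* S} (hf : Function.Surjective f) :
    IsNonabelianMaximalNormal f.ker := by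
  refine ⟨⟨⟨inferInstance, fun h => ?_⟩, fun N hN hle => ?_⟩, fun h => hS fun a b => ?_⟩
  · refine hS fun a b => ?_
    obtain ⟨a, rfl⟩ := hf a
    obtain ⟨b, rfl⟩ := hf b
    have ha : f a = 1 := MonoidHom.mem_ker.1 (h ▸ Subgroup.mem_top a)
    have hb : f b = 1 := MonoidHom.mem_ker.1 (h ▸ Subgroup.mem_top b)
    rw [ha, hb]
  · rcases (hN.1.map f hf).eq_bot_or_eq_top with h | h
    · exact (Subgroup.map_eq_bot_iff N).1 h
    · refine absurd ?_ hN.2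
      rw [← Subgroup.comap_map_eq_self hle, h, Subgroup.comap_top]
  · obtain ⟨a, rfl⟩ := hf a
    obtain ⟨b, rfl⟩ := hf b
    have := h (Subgroup.commutator_mem_commutator (Subgroup.mem_top a) (Subgroup.mem_top b))
    rw [MonoidHom.mem_ker, map_commutatorElement, commutatorElement_eq_one_iff_mul_comm] at this
    exact this

theorem IsFiniteProductOfNonabelianSimple.hasSemisimpleCommutator {H : Type u} [Group H]
    (h : IsFiniteProductOfNonabelianSimple H) : HasSemisimpleCommutator H := by
  classical
  obtain ⟨k, S, _, hS, ⟨e⟩⟩ := h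
  let f : ∀ i, H →* S i := fun i => (Pi.evalMonoidHom S i).comp e.toMonoidHom
  have hf : ∀ i, Function.Surjective (f i) := fun i =>
    (Function.surjective_eval i).comp e.surjective
  refine ⟨Finset.univ.image fun i => (f i).ker, ?_, ?_⟩
  · intro M hM
    obtain ⟨i, -, rfl⟩ := Finset.mem_image.1 hM
    have := (hS i).1
    exact isNonabelianMaximalNormal_ker (hS i).2 (hf i)
  · rw [eq_bot_iff]
    rintro x ⟨-, hx⟩
    rw [Subgroup.mem_bot, ← e.map_eq_one_iff]
    ext i
    have hle : (Finset.univ.image fun i => (f i).ker).inf id ≤ (f i).ker :=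
      Finset.inf_le (f := id) (Finset.mem_image_of_mem _ (Finset.mem_univ i))
    exact MonoidHom.mem_ker.1 (hle hx)

theorem InClassW.hasSemisimpleCommutator {G : Type u} [Group G] (h : InClassW G) :
    HasSemisimpleCommutator (G ⧸ nFrattini G) := by
  rcases h with h | h | h
  · exact .of_finite (nFrattini_quotient_nFrattini G)
  · exact .of_comm h
  · exact h.hasSemisimpleCommutator

end ClassW

/-! ### Conclusion -/

theorem exists_normallyGenerates_of_weight_lt {G : Type u} [Group G] {m : ℕ}
    (h : weight G < (m + 1 : ℕ)) : ∃ u : Fin m → G, NormallyGenerates u := by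
  simp only [weight, iInf_lt_iff] at h
  obtain ⟨s, hs, hlt⟩ := h
  have hle : s.encard ≤ m := Order.le_of_lt_add_one (by exact_mod_cast hlt)
  have hfin : s.Finite := Set.finite_of_encard_le_coe hle
  have hcard : s.ncard ≤ m := by
    rw [← hfin.cast_ncard_eq] at hle
    exact_mod_cast hle
  have := hfin.to_subtype
  let e : s ≃ Fin s.ncard := Finite.equivFinOfCardEq rfl
  -- A normally generating set with fewer than `m` elements is padded with 1.
  refine ⟨fun i => if hi : (i : ℕ) < s.ncard then e.symm ⟨i, hi⟩ else 1, ?_⟩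
  rw [NormallyGenerates, ← top_le_iff, ← hs]
  refine Subgroup.normalClosure_mono fun x hx => ⟨Fin.castLE hcard (e ⟨x, hx⟩), ?_⟩
  simp

theorem HasSemisimpleCommutator.exists_acEquivalent_cons {G : Type*} [Group G] [Group.FG G]
    (h : HasSemisimpleCommutator (G ⧸ nFrattini G)) {m : ℕ} [Nontrivial (Fin (m + 1))]
    {u : Fin m → G} (hu : NormallyGenerates u) {v : Fin (m + 1) → G} (hv : NormallyGenerates v) :
    ACEquivalent v (Fin.cons 1 u) := by
  have hq := QuotientGroup.mk'_surjective (nFrattini G)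
  have hu' : NormallyGenerates (Fin.cons 1 u : Fin (m + 1) → G) := by
    rw [NormallyGenerates, ← top_le_iff, ← hu, Fin.range_cons]
    exact Subgroup.normalClosure_mono (Set.subset_insert _ _)
  obtain ⟨u₁, hu₁⟩ : ∃ u₁ : Fin m → Abelianization (G ⧸ nFrattini G), NormallyGenerates u₁ :=
    ⟨_, (hu.map hq).map (QuotientGroup.mk'_surjective (commutator (G ⧸ nFrattini G)))⟩
  have hab := h.acEquivalent (fun _ _ hx hy => acEquivalent_of_commGroup hu₁ hx hy)
    (hv.map hq) (hu'.map hq)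
  obtain ⟨y, hvy, hy⟩ := hab.exists_lift hq
  refine hvy.trans ?_
  rw [← Fin.cons_self_tail y]
  exact acEquivalent_cons_of_eq hu (funext fun l => congr_fun hy l.succ) _ _

end AndrewsCurtis

theorem mainTheorem6 {G : Type*} [Group G] [Group.FG G] (hG : AndrewsCurtis.InClassW G) :
    AndrewsCurtis.SatisfiesWeakGAC G := by
  intro n hn v w hv hw
  obtain _ | m := n
  · simp at hn
  obtain ⟨u, hu⟩ := AndrewsCurtis.exists_normallyGenerates_of_weight_lt hn
  obtain _ | m := m
  -- For n = 1 the empty vector normally generates, so G is trivial; the general argument needs two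
  -- slots.
  · have : Subsingleton G := by
      rw [← Subgroup.subsingleton_iff, ← subsingleton_iff_bot_eq_top, ← hu]
      simp
    rw [Subsingleton.elim v w]
    exact .refl w
  · exact (hG.hasSemisimpleCommutator.exists_acEquivalent_cons hu hv).trans
      (hG.hasSemisimpleCommutator.exists_acEquivalent_cons hu hw).symm
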